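/- \textbf{Setting.} There are finite sets of students $\mathcal S$, districts $\mathcal D$, schools $\mathcal C$ and types $\mathcal T$. Each student $s$ has a home district and a type $\tau(s)$; each school $c$ has a home district and a capacity $q_c$; $k_d$ is the number of students whose home district is $d$. Each student $s$ has a strict preference order $P_s$ over all schools and the outside option of being unmatched, which is ranked last; $R_s$ is the associated weak order. A matching is a set of contracts $(s,c)$ between students and schools. It is feasible if every student has at most one contract and every school $c$ has at most $q_c$ contracts. There is a feasible initial matching $\tilde X$ in which every student has exactly one contract. A distribution is a vector $\xi=(\xi_c^t)\in\mathbb Z_+^{\mathcal C\times\mathcal T}$; $\xi(X)$ is the distribution whose $(c,t)$ entry is the number of type-$t$ students assigned to $c$ at $X$; $\chi_{c,t}$ is the distribution with one type-$t$ student at $c$ and no other students; and $$\Xi^0=\Big\{\xi : \sum_{c,t}\xi_c^t=\sum_d k_d \text{ and } \sum_t \xi_c^t\le q_c \text{ for all } c\Big\}.$$ A policy goal is a set $\Xi$ of distributions, and $X$ satisfies it if $\xi(X)\in\Xi$. For $f:\mathbb Z_+^{\mathcal C\times\mathcal T}\to\mathbb R$ and $\lambda\in\mathbb R$, the $(f,\lambda)$-policy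 is $\Xi(f,\lambda)=\{\xi : f(\xi)\ge\lambda\}$. The function $f$ is pseudo M-concave (on the domain $\Xi^0$) if for all distinct $\xi,\tilde\xi\in\Xi^0$ there exist $(c,t)$ and $(c',t')$ with $\xi_c^t>\tilde\xi_c^t$ and $\xi_{c'}^{t'}<\tilde\xi_{c'}^{t'}$ such that $\xi-\chi_{c,t}+\chi_{c',t'}$ and $\tilde\xi+\chi_{c,t}-\chi_{c',t'}$ belong to $\Xi^0$ and $$\min\{f(\xi-\chi_{c,t}+\chi_{c',t'}),\,f(\tilde\xi+\chi_{c,t}-\chi_{c',t'})\}\ \ge\ \min\{f(\xi),f(\tilde\xi)\}.$$ \textbf{Top trading cycles (TTC) for a policy goal $\Xi$.} The initial pair of a student $s$ with initial school $c_0$ is $(c_0,\tau(s))$. From $P_s$ one forms a strict order $\tilde P_s$ over school-type pairs that ranks the pairs $(c,\tau(s))$ as $P_s$ ranks the schools $c$, and ranks every pair with a type other than $\tau(s)$ below $(c_0,\tau(s))$ (and is otherwise arbitrary, depending only on $s$ and $P_s$). Every pair gives the highest priority to the students whose initial pair it is, and breaks ties by a fixed strict master priority list of the students. Initially no student is assigned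 and all pairs are in the market. In each step, let $X^n$ be the matching that consists of the assignments in the previous steps and the initial assignments of all other students. An unassigned student with initial pair $(c,t)$ is permissible to $(c',t')$ if $\xi(X^n)+\chi_{c',t'}-\chi_{c,t}\in\Xi\cap\Xi^0$. Each remaining pair points to the permissible unassigned student with the highest priority; pairs without a permissible unassigned student are removed. Each unassigned student points to the remaining pair that she ranks highest in $\tilde P_s$. All cycles are executed: each student in a cycle is assigned the pair she points to. This is repeated until no student remains; the outcome is the matching in which each student is matched with the school in the pair assigned to her. \textbf{Theorem.} Let $f$ be pseudo M-concave and let $\lambda\in\mathbb R$ satisfy $f(\xi(\tilde X))\ge\lambda$. Then TTC for the policy goal $\Xi(f,\lambda)$, with any master priority list and any choice of the orders $\tilde P_s$, has the following properties. At every preference profile its outcome $X$ is a feasible matching, and (i) $X$ satisfies the $(f,\lambda)$-policy: $f(\xi(X))\ge\lambda$; (ii) $X$ satisfies constrained efficiency: no feasible matching $Y$ with $f(\xi(Y))\ge\lambda$ is weakly preferred to $X$ by every student and strictly preferred by at least one; (iii) $X$ satisfies individual rationality: every student weakly prefers her outcome in $X$ to her initial school; and (iv) TTC is strategy-proof: for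 every preference profile, no student can obtain an outcome that she strictly prefers by misreporting her own preference. -/

import Mathlib

namespace SchoolChoice

/-- A strict preference (or priority) order on `A`: a strict total order. -/
structure StrictPref (A : Type*) where
  /-- `rel a b` means that `a` is ranked strictly above `b`. -/
  rel : A → A → Prop
  irrefl : ∀ a, ¬ rel a a
  trans : ∀ a b c, rel a b → rel b c → rel a c
  total : ∀ a b, a ≠ b → rel a b ∨ rel b a

/-- The weak order associated with a strict preference. -/
def StrictPref.weak {A : Type*} (P : StrictPref A) (a b : A) : Prop :=
  P.rel a b ∨ a = b

/-- A student's strict preference over all schools and the outside option `none` of being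
unmatched, which is the least preferred outcome. -/
structure SchoolPref (C : Type*) extends StrictPref (Option C) where
  outside_least : ∀ c : C, rel (some c) none

/-- The publicly known data of a problem, with students `S`, districts `D`, schools `C` and
types `T`. The contract between student `s` and school `c` is the pair `(s, c)`; its district is
`schoolDistrict c`. A matching is a set of contracts. -/
structure Problem (S D C T : Type*) [Fintype S] [Fintype D] [Fintype C] [Fintype T] where
  studentDistrict : S → D
  studentType : S → T
  schoolDistrict : C → D
  capacity : C → ℕ
  /-- The initial matching. -/
  initial : Set (S × C)
  /-- In the initial matching every student has exactly one contract. -/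
  initial_unique : ∀ s, ∃! c, (s, c) ∈ initial
  /-- The initial matching respects the capacities. -/
  initial_capacity : ∀ c, {s | (s, c) ∈ initial}.ncard ≤ capacity c

namespace Problem

variable {S D C T : Type*} [Fintype S] [Fintype D] [Fintype C] [Fintype T]
variable (E : Problem S D C T)

/-! ### Matchings, distributions and policy goals -/

/-- A matching is feasible if every student has at most one contract and every school has at most
as many contracts as its capacity. -/
def Feasible (X : Set (S × C)) : Prop :=
  (∀ s c c', (s, c) ∈ X → (s, c') ∈ X → c = c') ∧
    ∀ c, {s | (s, c) ∈ X}.ncard ≤ E.capacity c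

open Classical in
/-- The outcome of student `s` at `X`: her school, or `none` if she is unmatched. (Used for
matchings with at most one contract for every student.) -/
noncomputable def outcome (X : Set (S × C)) (s : S) : Option C :=
  if h : ∃ c, (s, c) ∈ X then some h.choose else none

/-- The distribution associated with `X`: the number of type-`t` students assigned to `c`.
Distributions are functions from school-type pairs to natural numbers. -/
noncomputable def dist (X : Set (S × C)) : C × T → ℕ :=
  fun p => {s | (s, p.1) ∈ X ∧ E.studentType s = p.2}.ncard

/-- The number of students whose home district is `d`. -/
noncomputable def districtSize (d : D) : ℕ := {s | E.studentDistrict s = d}.ncard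

/-- The policy that each student is matched without assigning any school more students than its
capacity. -/
def fullPolicy : Set (C × T → ℕ) :=
  {ξ | ∑ p, ξ p = ∑ d, E.districtSize d ∧ ∀ c, ∑ t, ξ (c, t) ≤ E.capacity c}

open Classical in
/-- The distribution with one type-`t` student at school `c`, for `p = (c, t)`, and no other
students. -/
noncomputable def unitDist (p : C × T) : C × T → ℕ := fun r => if r = p then 1 else 0

/-- The distribution `ξ - χ_p + χ_r`. (Only used when `ξ p` is positive, so that the subtraction
does not truncate.) -/
noncomputable def exchange (ξ : C × T → ℕ) (p r : C × T) : C × T → ℕ :=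
  ξ - unitDist p + unitDist r

/-- The policy given by the policy function `f` and the threshold `l`. -/
def funPolicy (f : (C × T → ℕ) → ℝ) (l : ℝ) : Set (C × T → ℕ) := {ξ | l ≤ f ξ}

/-- Pseudo M-concavity of a policy function on the domain `fullPolicy`: for distinct `ξ`, `η` in
the domain there is an exchange that stays in the domain and satisfies the inequality. -/
def PseudoMConcave (f : (C × T → ℕ) → ℝ) : Prop :=
  ∀ ξ ∈ E.fullPolicy, ∀ η ∈ E.fullPolicy, ξ ≠ η →
    ∃ p r : C × T, η p < ξ p ∧ ξ r < η r ∧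
      exchange ξ p r ∈ E.fullPolicy ∧ exchange η r p ∈ E.fullPolicy ∧
      min (f ξ) (f η) ≤ min (f (exchange ξ p r)) (f (exchange η r p))

/-! ### The hypothetical problem -/

/-- The initial school of a student. -/
noncomputable def initialSchool (s : S) : C := (E.initial_unique s).choose

/-- The initial school-type pair of a student. -/
noncomputable def initialPair (s : S) : C × T := (E.initialSchool s, E.studentType s)

/-- `Q` is a preference of student `s` over school-type pairs that corresponds to her preference
`P` over schools: pairs with her own type are ranked as in `P`, and pairs with another type are
ranked below her initial pair (and otherwise arbitrarily). -/
def IsHypotheticalPref (s : S) (P : SchoolPref C) (Q : StrictPref (C × T)) : Prop :=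
  (∀ c c' : C, P.rel (some c) (some c') ↔
      Q.rel (c, E.studentType s) (c', E.studentType s)) ∧
    ∀ (c : C) (t : T), t ≠ E.studentType s → Q.rel (E.initialPair s) (c, t)

/-- Student `s` has a higher priority than `s'` at pair `p`: students who are initially matched
with `p` come first, and ties are broken by the master priority list. -/
def HigherPriority (master : StrictPref S) (p : C × T) (s s' : S) : Prop :=
  (E.initialPair s = p ∧ E.initialPair s' ≠ p) ∨
    ((E.initialPair s = p ↔ E.initialPair s' = p) ∧ master.rel s s')

/-! ### The top trading cycles algorithm -/

end Problem

/-- A state of the algorithm: the assignments made so far and the school-type pairs that have not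
been removed from the market. -/
structure TTCState (S C T : Type*) where
  assigned : S → Option (C × T)
  remaining : Set (C × T)

namespace Problem

variable {S D C T : Type*} [Fintype S] [Fintype D] [Fintype C] [Fintype T]
variable (E : Problem S D C T) (master : StrictPref S) (Ξ : Set (C × T → ℕ))
  (Q : S → StrictPref (C × T)) (σ : TTCState S C T)

/-- The state before the first step. -/
def initState (S C T : Type*) : TTCState S C T where
  assigned := fun _ => none
  remaining := Set.univ

/-- The matching that consists of the assignments made so far and the initial assignments of all
students who have not been processed. -/
def currentMatching : Set (S × C) :=
  {x | x.2 = ((σ.assigned x.1).getD (E.initialPair x.1)).1}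

/-- An unassigned student `s` is permissible to `p` if moving her from her initial pair to `p`
gives a distribution in the policy goal at which every student is matched and no school has more
students than its capacity. -/
def Permissible (s : S) (p : C × T) : Prop :=
  σ.assigned s = none ∧
    exchange (E.dist (E.currentMatching σ)) (E.initialPair s) p ∈ Ξ ∩ E.fullPolicy

/-- The pairs that remain after the removal of those without a permissible student. -/
def remainingPairs : Set (C × T) := {p | p ∈ σ.remaining ∧ ∃ s, E.Permissible Ξ σ s p}

/-- Pair `p` points to student `s`: the permissible student with the highest priority. -/
def PairPoints (p : C × T) (s : S) : Prop :=
  p ∈ E.remainingPairs Ξ σ ∧ E.Permissible Ξ σ s p ∧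
    ∀ s', E.Permissible Ξ σ s' p → s' ≠ s → E.HigherPriority master p s s'

/-- Unassigned student `s` points to pair `p`: her highest ranked remaining pair. -/
def StudentPoints (s : S) (p : C × T) : Prop :=
  σ.assigned s = none ∧ p ∈ E.remainingPairs Ξ σ ∧
    ∀ r ∈ E.remainingPairs Ξ σ, r ≠ p → (Q s).rel p r

/-- Student `s` points to a pair that points to student `s'`. -/
def PointsVia (s s' : S) : Prop :=
  ∃ p, E.StudentPoints Ξ Q σ s p ∧ E.PairPoints master Ξ σ p s'

/-- Student `s` is part of a cycle. -/
def InCycle (s : S) : Prop := Relation.TransGen (E.PointsVia master Ξ Q σ) s s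

open Classical in
/-- One step of the algorithm: all cycles are executed, and every student in a cycle is assigned
the pair that she points to. -/
noncomputable def step : TTCState S C T where
  assigned := fun s =>
    if h : E.InCycle master Ξ Q σ s ∧ ∃ p, E.StudentPoints Ξ Q σ s p then some h.2.choose
    else σ.assigned s
  remaining := E.remainingPairs Ξ σ

/-- The state after `n` steps. -/
noncomputable def stateAfter (n : ℕ) : TTCState S C T :=
  (E.step master Ξ Q)^[n] (initState S C T)

/-- The outcome of the algorithm: the matching induced by the assignments made in all steps.
(Assignments are never revised.) -/
def ttcOutcome : Set (S × C) :=
  {x | ∃ n t, (E.stateAfter master Ξ Q n).assigned x.1 = some (x.2, t)}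

/-- The top trading cycles mechanism for the policy goal `Ξ`. Student `s` with the reported
preference `P s` has the preference `hyp s (P s)` over school-type pairs. -/
def ttc (hyp : S → SchoolPref C → StrictPref (C × T)) (P : S → SchoolPref C) : Set (S × C) :=
  E.ttcOutcome master Ξ (fun s => hyp s (P s))

/-! ### Properties of matchings and mechanisms -/

/-- Every student weakly prefers her outcome in `X` to her initial school. -/
def IndividuallyRational (P : S → SchoolPref C) (X : Set (S × C)) : Prop :=
  E.Feasible X ∧ ∀ s, (P s).weak (outcome X s) (outcome E.initial s)

/-- `X` Pareto dominates `Y`. -/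
def ParetoDominates (P : S → SchoolPref C) (X Y : Set (S × C)) : Prop :=
  (∀ s, (P s).weak (outcome X s) (outcome Y s)) ∧
    ∃ s, (P s).rel (outcome X s) (outcome Y s)

/-- `X` is a feasible matching satisfying the policy goal, and no feasible matching that satisfies
the policy goal Pareto dominates it. -/
def ConstrainedEfficient (P : S → SchoolPref C) (X : Set (S × C)) : Prop :=
  E.Feasible X ∧ E.dist X ∈ Ξ ∧
    ¬ ∃ Y, E.Feasible Y ∧ E.dist Y ∈ Ξ ∧ ParetoDominates P Y X

open Classical in
/-- No student can get a strictly more preferred outcome by misreporting her preference. -/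
def StrategyProof (φ : (S → SchoolPref C) → Set (S × C)) : Prop :=
  ∀ (s : S) (P : S → SchoolPref C) (P' : SchoolPref C),
    ¬ (P s).rel (outcome (φ (Function.update P s P')) s) (outcome (φ P) s)

end Problem

end SchoolChoice

open SchoolChoice SchoolChoice.Problem

/-! Why the theorem is true. Let `B` be the set of distributions in the policy goal at which everybody
is matched within the capacities, as integer vectors (`goalVec`). Pseudo M-concavity says that two
distinct members of `B` can be moved towards each other by *some* exchange (`WeakExchange`). By
induction on the `ℓ¹`-distance, the coordinate that loses a unit, or the one that gains it, can then
be prescribed (`exists_move_from`, `exists_move_to`), so `B` behaves like the set of bases of a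
matroid.

The students in the cycles of one step, in the order of the master list, give a triangular system of
moves: a pair without an unassigned initial student points to the highest permissible student, so
it accepts no unit from a student with higher priority (`PairPoints.move_notMem`). Executed from
the highest student down, the moves do not affect what can be moved to the later targets
(`move_move_mem_iff`), so together they stay in `B` (`moveAll_mem_and_iff`). This gives feasibility
and the policy goal. Moreover, they do not let a student of higher priority become permissible
(`moveAll_notMem`), so a pair keeps pointing to the same student until she is assigned
(`PairPoints.step`).

Individual rationality holds because a student is always permissible to her initial pair. For
efficiency (`IsRun.eq_of_weak`), the first student who gets a pair other than in a dominating
matching prefers a pair that was removed earlier, but an exchange with the distribution of the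
dominating matching yields a student who was permissible to it. For strategy-proofness
(`IsRun.not_rel_of_deviation`), the report of a student does not matter before she is in a cycle,
and whatever she could get by closing a cycle early stays on offer until she leaves
(`Offered.step`). -/

namespace SchoolChoice

/-! ### Sets of integer vectors with the exchange property -/

section Exchange

variable {V : Type*}

open Classical in
/-- The integer vector obtained from `ξ` by moving one unit from `x` to `y`. Working over `ℤ`
makes moves invertible and `move ξ x x = ξ` unconditional. -/
noncomputable def move (ξ : V → ℤ) (x y : V) : V → ℤ := ξ - Pi.single x 1 + Pi.single y 1

/-- The weak simultaneous exchange property: two distinct members of `B` can be moved towards each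
other by *some* exchange. -/
def WeakExchange (B : Set (V → ℤ)) : Prop :=
  ∀ ξ ∈ B, ∀ η ∈ B, ξ ≠ η → ∃ p r, η p < ξ p ∧ ξ r < η r ∧ move ξ p r ∈ B ∧ move η r p ∈ B

open Classical in
/-- The vector that counts how often each value is taken by `h`. -/
noncomputable def countVec {S : Type*} [Fintype S] (h : S → V) : V → ℤ :=
  ∑ s, Pi.single (h s) 1

open Classical in
lemma countVec_apply {S : Type*} [Fintype S] (h : S → V) (v : V) :
    countVec h v = ∑ s, if h s = v then 1 else 0 := by
  simp [countVec, Pi.single_apply, eq_comm]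

@[simp] lemma move_self (ξ : V → ℤ) (x : V) : move ξ x x = ξ := by
  simp [move]

open Classical in
lemma move_apply (ξ : V → ℤ) (x y z : V) :
    move ξ x y z = ξ z - (if z = x then 1 else 0) + (if z = y then 1 else 0) := by
  simp [move, Pi.single_apply]

lemma move_comm (ξ : V → ℤ) (x y z w : V) : move (move ξ x y) z w = move (move ξ z w) x y := by
  simp only [move]; abel

lemma move_trans (ξ : V → ℤ) (x y z : V) : move (move ξ x y) y z = move ξ x z := by
  simp only [move]; abel

lemma sum_abs_move_lt [Fintype V] {ξ η : V → ℤ} {p r : V} (hp : η p < ξ p) (hr : ξ r < η r) :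
    ∑ v, |ξ v - move η r p v| < ∑ v, |ξ v - η v| := by
  classical
  have hpr : p ≠ r := by rintro rfl; omega
  refine Finset.sum_lt_sum (fun v _ => ?_) ⟨p, Finset.mem_univ _, ?_⟩
  · rw [move_apply]
    by_cases h1 : v = r
    · subst h1
      rw [if_pos rfl, if_neg hpr.symm, abs_of_neg (by omega : ξ v - η v < 0), abs_le]
      constructor <;> omega
    · by_cases h2 : v = p
      · subst h2
        rw [if_neg h1, if_pos rfl, abs_of_pos (by omega : 0 < ξ v - η v), abs_le]
        constructor <;> omega
      · simp [h1, h2]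
  · rw [move_apply, if_neg hpr, if_pos rfl, abs_of_pos (by omega : 0 < ξ p - η p), abs_lt]
    constructor <;> omega

namespace WeakExchange

variable [Fintype V] {B : Set (V → ℤ)}

/-- The weak exchange property implies that a unit can be moved away from *any* coordinate in
which `ξ` exceeds `η`. If the exchange supplied uses another coordinate, it brings `η` closer to
`ξ` without affecting the claim. -/
lemma exists_move_from (hB : WeakExchange B) {ξ : V → ℤ} (hξ : ξ ∈ B) :
    ∀ {η : V → ℤ}, η ∈ B → ∀ {x : V}, η x < ξ x → ∃ r, ξ r < η r ∧ move ξ x r ∈ B := by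
  classical
  suffices H : ∀ (n : ℕ) (η : V → ℤ), ∑ v, |ξ v - η v| < n → η ∈ B → ∀ x, η x < ξ x →
      ∃ r, ξ r < η r ∧ move ξ x r ∈ B by
    intro η hη x hx
    refine H ((∑ v, |ξ v - η v|).toNat + 1) η ?_ hη x hx
    push_cast
    have := Int.self_le_toNat (∑ v, |ξ v - η v|)
    omega
  intro n
  induction n with
  | zero =>
    intro η h
    have : 0 ≤ ∑ v, |ξ v - η v| := Finset.sum_nonneg fun _ _ => abs_nonneg _
    push_cast at h
    omega
  | succ n ih =>
    intro η hn hη x hx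
    obtain ⟨p, r, hp, hr, h1, h2⟩ := hB ξ hξ η hη (by rintro rfl; omega)
    by_cases hpx : p = x
    · exact ⟨r, hr, hpx ▸ h1⟩
    · have hpr : p ≠ r := by rintro rfl; omega
      have hlt := sum_abs_move_lt hp hr
      push_cast at hn
      obtain ⟨r', hr', h'⟩ := ih (move η r p) (by omega) h2 x (by
        rw [move_apply, if_neg (Ne.symm hpx)]; split_ifs <;> omega)
      refine ⟨r', ?_, h'⟩
      rw [move_apply] at hr'
      by_cases e : r' = p
      · subst e; rw [if_neg hpr, if_pos rfl] at hr'; omega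
      · rw [if_neg e] at hr'; split_ifs at hr' <;> omega

/-- The counterpart of `exists_move_from` for a coordinate in which `η` exceeds `ξ`. -/
lemma exists_move_to (hB : WeakExchange B) {ξ : V → ℤ} (hξ : ξ ∈ B) :
    ∀ {η : V → ℤ}, η ∈ B → ∀ {y : V}, ξ y < η y → ∃ r, η r < ξ r ∧ move ξ r y ∈ B := by
  classical
  suffices H : ∀ (n : ℕ) (η : V → ℤ), ∑ v, |ξ v - η v| < n → η ∈ B → ∀ y, ξ y < η y →
      ∃ r, η r < ξ r ∧ move ξ r y ∈ B by
    intro η hη x hx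
    refine H ((∑ v, |ξ v - η v|).toNat + 1) η ?_ hη x hx
    push_cast
    have := Int.self_le_toNat (∑ v, |ξ v - η v|)
    omega
  intro n
  induction n with
  | zero =>
    intro η h
    have : 0 ≤ ∑ v, |ξ v - η v| := Finset.sum_nonneg fun _ _ => abs_nonneg _
    push_cast at h
    omega
  | succ n ih =>
    intro η hn hη y hy
    obtain ⟨p, r, hp, hr, h1, h2⟩ := hB ξ hξ η hη (by rintro rfl; omega)
    by_cases hry : r = y
    · exact ⟨p, hp, hry ▸ h1⟩
    · have hpr : p ≠ r := by rintro rfl; omega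
      have hlt := sum_abs_move_lt hp hr
      push_cast at hn
      obtain ⟨r', hr', h'⟩ := ih (move η r p) (by omega) h2 y (by
        rw [move_apply, if_neg (Ne.symm hry)]; split_ifs <;> omega)
      refine ⟨r', ?_, h'⟩
      rw [move_apply] at hr'
      by_cases e : r' = r
      · subst e; rw [if_pos rfl, if_neg hpr.symm] at hr'; omega
      · rw [if_neg e] at hr'; split_ifs at hr' <;> omega

/-- Executing a feasible move `x → y` does not change which units can be moved to `w`, provided
that the unit at `x` could not be moved to `w`. -/
lemma move_move_mem_iff (hB : WeakExchange B) {ξ : V → ℤ} {x y w : V} (hξ : ξ ∈ B)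
    (h1 : move ξ x y ∈ B) (hw : move ξ x w ∉ B) (z : V) :
    move (move ξ x y) z w ∈ B ↔ move ξ z w ∈ B := by
  classical
  have hwx : w ≠ x := by rintro rfl; exact hw (by simpa using hξ)
  have hwy : w ≠ y := by rintro rfl; exact hw h1
  constructor
  · intro h
    by_cases hwz : w = z
    · subst hwz; simpa using hξ
    · obtain ⟨r, hr, hr'⟩ := hB.exists_move_to hξ h (y := w) (by
        simp only [move_apply, if_neg hwx, if_neg hwz, if_neg hwy]; simp)
      by_cases hrz : r = z
      · exact hrz ▸ hr'
      · by_cases hrx : r = x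
        · exact absurd (hrx ▸ hr') hw
        · simp only [move_apply, if_neg hrz, if_neg hrx] at hr
          split_ifs at hr <;> omega
  · intro h
    have hxz : x ≠ z := by rintro rfl; exact hw h
    by_cases hxy : x = y
    · subst hxy; simpa using h
    · obtain ⟨r, hr, hr'⟩ := hB.exists_move_from h h1 (x := x) (by
        simp only [move_apply, if_neg hwx.symm, if_neg hxz, if_neg hxy]; simp)
      by_cases hry : r = y
      · subst hry; rwa [move_comm]
      · by_cases hrz : r = z
        · subst hrz
          rw [move_comm, move_trans] at hr'
          exact absurd hr' hw
        · simp only [move_apply, if_neg hry, if_neg hrz] at hr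
          split_ifs at hr <;> omega

/-- If the unit at `t` can be moved neither to `y` nor to `w`, then it still cannot be moved to `w`
after any feasible move to `y`. -/
lemma move_move_notMem (hB : WeakExchange B) {ξ : V → ℤ} {x y w t : V} (hξ : ξ ∈ B)
    (h1 : move ξ x y ∈ B) (hy : move ξ t y ∉ B) (hw : move ξ t w ∉ B) :
    move (move ξ x y) t w ∉ B := by
  classical
  intro h
  have hxt : t ≠ x := by rintro rfl; exact hy h1
  have hty : t ≠ y := by rintro rfl; exact hy (by simpa using hξ)
  have htw : t ≠ w := by rintro rfl; exact hw (by simpa using hξ)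
  obtain ⟨r, hr, hr'⟩ := hB.exists_move_from hξ h (x := t) (by
    simp only [move_apply, if_neg hxt, if_neg hty, if_neg htw]; simp)
  by_cases hry : r = y
  · exact hy (hry ▸ hr')
  · by_cases hrw : r = w
    · exact hw (hrw ▸ hr')
    · simp only [move_apply, if_neg hry, if_neg hrw] at hr
      split_ifs at hr <;> omega

end WeakExchange

/-! ### Simultaneous moves -/

open Classical in
/-- The vector obtained from `ξ` by moving one unit from `x k` to `y k` for every `k ∈ K`. -/
noncomputable def moveAll {S : Type*} (ξ : V → ℤ) (x y : S → V) (K : Finset S) : V → ℤ :=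
  ξ + ∑ k ∈ K, (Pi.single (y k) 1 - Pi.single (x k) 1)

/-- The moves `x k → y k`, `k ∈ K`, are individually feasible at `ξ`, and the exchange graph is
triangular for the order `rel`: no unit of a higher ranked member can be moved to the target of a
lower ranked one. -/
structure Triangular {S : Type*} (B : Set (V → ℤ)) (rel : S → S → Prop) (ξ : V → ℤ)
    (x y : S → V) (K : Finset S) : Prop where
  mem : ∀ k ∈ K, move ξ (x k) (y k) ∈ B
  notMem : ∀ k ∈ K, ∀ j ∈ K, rel j k → move ξ (x j) (y k) ∉ B

lemma Triangular.subset {S : Type*} {B : Set (V → ℤ)} {rel : S → S → Prop} {ξ : V → ℤ}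
    {x y : S → V} {K L : Finset S} (h : Triangular B rel ξ x y K) (hL : L ⊆ K) :
    Triangular B rel ξ x y L :=
  ⟨fun k hk => h.mem k (hL hk), fun k hk j hj => h.notMem k (hL hk) j (hL hj)⟩

section MoveAll

variable {S : Type*} {x y : S → V}

@[simp] lemma moveAll_empty (ξ : V → ℤ) : moveAll ξ x y ∅ = ξ := by simp [moveAll]

lemma moveAll_insert [DecidableEq S] (ξ : V → ℤ) {k : S} {K : Finset S} (hk : k ∉ K) :
    moveAll ξ x y (insert k K) = move (moveAll ξ x y K) (x k) (y k) := by
  simp only [moveAll, move, Finset.sum_insert hk]; abel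

lemma moveAll_union [DecidableEq S] (ξ : V → ℤ) {K L : Finset S} (h : Disjoint K L) :
    moveAll ξ x y (K ∪ L) = moveAll (moveAll ξ x y K) x y L := by
  simp only [moveAll, Finset.sum_union h]; abel

end MoveAll

/-- Induction on a finset that adds elements in decreasing order of a strict order. -/
lemma StrictPref.finset_induction {S : Type*} [DecidableEq S] (m : StrictPref S)
    {motive : Finset S → Prop} (empty : motive ∅)
    (insert : ∀ k K, k ∉ K → (∀ j ∈ K, m.rel j k) → motive K → motive (insert k K)) :
    ∀ K, motive K := by
  intro K
  induction K using Finset.strongInduction with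
  | H K ih =>
    rcases K.eq_empty_or_nonempty with rfl | hne
    · exact empty
    · obtain ⟨k, hk, hmin⟩ : ∃ k ∈ K, ∀ j ∈ K, ¬ m.rel k j := by
        have : IsStrictOrder S (Function.swap m.rel) :=
          { irrefl := m.irrefl, trans := fun a b c h1 h2 => m.trans _ _ _ h2 h1 }
        have hwf := Set.Finite.wellFoundedOn (r := Function.swap m.rel) K.finite_toSet
        obtain ⟨k, hk⟩ := hwf.has_min Set.univ ⟨⟨hne.choose, hne.choose_spec⟩, trivial⟩
        exact ⟨k, k.2, fun j hj h => hk.2 ⟨j, hj⟩ trivial h⟩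
      rw [← Finset.insert_erase hk]
      refine insert k _ (Finset.notMem_erase _ _) (fun j hj => ?_) (ih _ (Finset.erase_ssubset hk))
      have hj' := Finset.mem_erase.1 hj
      exact (m.total j k hj'.1).resolve_right (hmin j hj'.2)

namespace WeakExchange

variable [Fintype V] {B : Set (V → ℤ)} {S : Type*} {x y : S → V}

/-- Triangular moves are jointly feasible: executed in decreasing order of rank, none of them
affects what can be moved to the targets of the later ones. -/
lemma moveAll_mem_and_iff (hB : WeakExchange B) (m : StrictPref S) {ξ : V → ℤ} (hξ : ξ ∈ B) :
    ∀ K : Finset S, Triangular B m.rel ξ x y K →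
      moveAll ξ x y K ∈ B ∧ ∀ w, (∀ k ∈ K, move ξ (x k) w ∉ B) →
        ∀ z, move (moveAll ξ x y K) z w ∈ B ↔ move ξ z w ∈ B := by
  classical
  intro K
  induction K using m.finset_induction with
  | empty => intro _; simpa using hξ
  | insert k K hk hlow ih =>
    intro hK
    obtain ⟨h1, h2⟩ := ih (hK.subset (Finset.subset_insert _ _))
    have hk1 : move (moveAll ξ x y K) (x k) (y k) ∈ B :=
      (h2 (y k) (fun j hj => hK.notMem k (Finset.mem_insert_self _ _) j
        (Finset.mem_insert_of_mem hj) (hlow j hj)) (x k)).2 (hK.mem k (Finset.mem_insert_self _ _))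
    rw [moveAll_insert ξ hk]
    refine ⟨hk1, fun w hw z => ?_⟩
    have hw' := h2 w fun j hj => hw j (Finset.mem_insert_of_mem hj)
    rw [hB.move_move_mem_iff h1 hk1 (by rw [hw']; exact hw k (Finset.mem_insert_self _ _)) z, hw']

/-- If the unit at `t` can be moved neither to `w` nor to any target, this also holds for `w` after
the moves. -/
lemma moveAll_notMem_aux (hB : WeakExchange B) (m : StrictPref S) {ξ : V → ℤ} (hξ : ξ ∈ B) {t : V} :
    ∀ K : Finset S, Triangular B m.rel ξ x y K → (∀ k ∈ K, move ξ t (y k) ∉ B) →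
      ∀ w, move ξ t w ∉ B → move (moveAll ξ x y K) t w ∉ B := by
  classical
  intro K
  induction K using m.finset_induction with
  | empty => intro _ _ w hw; simpa using hw
  | insert k K hk hlow ih =>
    intro hK ht w hw
    have hK' := hK.subset (Finset.subset_insert _ _)
    have ih' := ih hK' fun j hj => ht j (Finset.mem_insert_of_mem hj)
    have h1 := (hB.moveAll_mem_and_iff m hξ _ hK).1
    rw [moveAll_insert ξ hk] at h1 ⊢
    exact hB.move_move_notMem (hB.moveAll_mem_and_iff m hξ _ hK').1 h1
      (ih' _ (ht k (Finset.mem_insert_self _ _))) (ih' w hw)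

/-- Triangular moves do not create the possibility of moving the unit at `t` to `w`, when `w` and
the targets of the members ranked below `s` accept no unit from `t`, and `w` accepts none from the
members ranked above `s`. -/
lemma moveAll_notMem (hB : WeakExchange B) (m : StrictPref S) {ξ : V → ℤ} (hξ : ξ ∈ B)
    {K : Finset S} (hK : Triangular B m.rel ξ x y K) {s : S} (hs : s ∉ K) {t w : V}
    (hhigh : ∀ k ∈ K, m.rel k s → move ξ (x k) w ∉ B)
    (hlow : ∀ k ∈ K, m.rel s k → move ξ t (y k) ∉ B) (htw : move ξ t w ∉ B) :
    move (moveAll ξ x y K) t w ∉ B := by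
  classical
  -- the moves ranked above `s` come first; they preserve everything relevant for the others
  set H := K.filter fun k => m.rel k s with hH
  set L := K.filter fun k => ¬ m.rel k s with hL
  have hlow' : ∀ k ∈ L, k ∈ K ∧ m.rel s k := fun k hk => by
    rw [hL, Finset.mem_filter] at hk
    refine ⟨hk.1, (m.total k s ?_).resolve_left hk.2⟩
    rintro rfl; exact hs hk.1
  have hHK : H ⊆ K := Finset.filter_subset _ _
  have hunion : H ∪ L = K := Finset.filter_union_filter_not_eq _ _
  obtain ⟨h1, h2⟩ := hB.moveAll_mem_and_iff m hξ H (hK.subset hHK)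
  have hpres : ∀ k ∈ L, ∀ z, move (moveAll ξ x y H) z (y k) ∈ B ↔ move ξ z (y k) ∈ B :=
    fun k hk => h2 (y k) fun j hj => hK.notMem k (hlow' k hk).1 j (hHK hj)
      (m.trans _ _ _ (Finset.mem_filter.1 hj).2 (hlow' k hk).2)
  rw [← hunion, moveAll_union ξ (Finset.disjoint_filter_filter_not _ _ _)]
  refine hB.moveAll_notMem_aux m h1 L ⟨fun k hk => ?_, fun k hk j hj hjk => ?_⟩ (fun k hk => ?_) w ?_
  · rw [hpres k hk]; exact hK.mem k (hlow' k hk).1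
  · rw [hpres k hk]; exact hK.notMem k (hlow' k hk).1 j (hlow' j hj).1 hjk
  · rw [hpres k hk]; exact hlow k (hlow' k hk).1 (hlow' k hk).2
  · rw [h2 w fun k hk => hhigh k (hHK hk) (Finset.mem_filter.1 hk).2]; exact htw

end WeakExchange

end Exchange

/-! ### Strict orders -/

lemma StrictPref.asymm {A : Type*} (P : StrictPref A) {a b : A} (h : P.rel a b) : ¬ P.rel b a :=
  fun h' => P.irrefl a (P.trans _ _ _ h h')

lemma StrictPref.not_rel_of_weak {A : Type*} (P : StrictPref A) {a b : A} (h : P.weak a b) :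
    ¬ P.rel b a := by
  rcases h with h | rfl
  · exact P.asymm h
  · exact P.irrefl _

/-- A finite nonempty set has a member that a given strict order ranks highest. -/
lemma StrictPref.exists_top {A : Type*} [Finite A] (P : StrictPref A) {s : Set A}
    (hs : s.Nonempty) : ∃ a ∈ s, ∀ b ∈ s, b ≠ a → P.rel a b := by
  have : IsStrictOrder A P.rel := { irrefl := P.irrefl, trans := P.trans }
  obtain ⟨a, ha, h⟩ := (Finite.wellFounded_of_trans_of_irrefl P.rel).has_min s hs
  exact ⟨a, ha, fun b hb hba => (P.total b a hba).resolve_left (h b hb)⟩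

namespace Problem

variable {S D C T : Type*} [Fintype S] [Fintype D] [Fintype C] [Fintype T]
variable (E : Problem S D C T)

/-! ### Matchings in which every student is matched -/

/-- The matching that assigns every student `s` to the school `g s`. -/
def graph {S C : Type*} (g : S → C) : Set (S × C) := {x | x.2 = g x.1}

@[simp] lemma mem_graph {S C : Type*} {g : S → C} {s : S} {c : C} :
    (s, c) ∈ graph g ↔ c = g s := Iff.rfl

lemma outcome_graph {S C : Type*} [Fintype C] (g : S → C) (s : S) :
    outcome (graph g) s = some (g s) := by
  have h : ∃ c, (s, c) ∈ graph g := ⟨g s, rfl⟩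
  rw [outcome, dif_pos h]
  exact congrArg some h.choose_spec

lemma eq_graph_of_outcome {X : Set (S × C)} {g : S → C} (hX : E.Feasible X)
    (h : ∀ s, outcome X s = some (g s)) : X = graph g := by
  have key : ∀ s, (s, g s) ∈ X := fun s => by
    have hs := h s
    rw [outcome] at hs
    split_ifs at hs with hc
    have := hc.choose_spec
    rwa [Option.some.inj hs] at this
  ext ⟨s, c⟩
  rw [mem_graph]
  exact ⟨fun hc => hX.1 s _ _ hc (key s), fun hc => hc ▸ key s⟩

lemma initial_eq_graph : E.initial = graph E.initialSchool := by
  ext ⟨s, c⟩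
  have h := (E.initial_unique s).choose_spec
  exact ⟨fun hc => h.2 c hc, fun hc => by rw [mem_graph.1 hc]; exact h.1⟩

open Classical in
lemma dist_graph (g : S → C) (p : C × T) :
    E.dist (graph g) p = (Finset.univ.filter fun s => (g s, E.studentType s) = p).card := by
  rw [dist, Set.ncard_eq_toFinset_card']
  congr 1
  ext s
  simp [Prod.ext_iff, eq_comm]

/-- The distribution `ξ` as an integer vector. -/
def toInt {V : Type*} (ξ : V → ℕ) : V → ℤ := fun v => ξ v

lemma toInt_injective {V : Type*} : Function.Injective (toInt (V := V)) := fun _ _ h =>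
  funext fun v => Int.ofNat_inj.1 (congrFun h v)

lemma toInt_dist_graph (g : S → C) :
    toInt (E.dist (graph g)) = countVec fun s => (g s, E.studentType s) := by
  funext p
  rw [toInt, dist_graph, Finset.card_filter, countVec_apply]
  push_cast
  congr!

lemma sum_dist_graph (g : S → C) : ∑ p, E.dist (graph g) p = Fintype.card S := by
  classical
  simp only [dist_graph]
  exact (Finset.card_eq_sum_card_fiberwise (f := fun s => (g s, E.studentType s))
    (t := Finset.univ) (fun _ _ => Finset.mem_coe.2 (Finset.mem_univ _))).symm

lemma sum_dist_graph_school (g : S → C) (c : C) :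
    ∑ t, E.dist (graph g) (c, t) = {s | (s, c) ∈ graph g}.ncard := by
  classical
  simp only [dist_graph, mem_graph]
  rw [Set.ncard_eq_toFinset_card']
  rw [Finset.card_eq_sum_card_fiberwise (f := E.studentType)
    (t := Finset.univ) (fun _ _ => Finset.mem_coe.2 (Finset.mem_univ _))]
  refine Finset.sum_congr rfl fun t _ => congrArg _ ?_
  ext s
  simp [eq_comm]

lemma sum_districtSize : ∑ d, E.districtSize d = Fintype.card S := by
  classical
  rw [← Finset.card_univ, Finset.card_eq_sum_card_fiberwise (f := E.studentDistrict)
    (t := Finset.univ) (fun _ _ => Finset.mem_coe.2 (Finset.mem_univ _))]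
  refine Finset.sum_congr rfl fun d _ => ?_
  rw [districtSize, Set.ncard_eq_toFinset_card']
  congr 1
  ext s
  simp

lemma feasible_graph_iff (g : S → C) :
    E.Feasible (graph g) ↔ E.dist (graph g) ∈ E.fullPolicy := by
  simp only [Feasible, fullPolicy, Set.mem_ofPred_eq, sum_dist_graph, sum_districtSize,
    sum_dist_graph_school, true_and]
  exact ⟨fun h => h.2, fun h => ⟨fun s c c' hc hc' => hc.trans hc'.symm, h⟩⟩

lemma feasible_initial : E.Feasible E.initial :=
  ⟨fun s _ _ h h' => (E.initial_unique s).unique h h', E.initial_capacity⟩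

/-! ### Distributions that satisfy the policy goal, as integer vectors -/

lemma toInt_exchange {V W : Type*} {ξ : V × W → ℕ} {p r : V × W} (hp : 0 < ξ p) :
    toInt (exchange ξ p r) = move (toInt ξ) p r := by
  classical
  funext v
  simp only [toInt, exchange, unitDist, move_apply, Pi.add_apply, Pi.sub_apply]
  by_cases h : v = p
  · subst h
    simp only [if_true]
    split_ifs <;> push_cast <;> omega
  · simp only [if_neg h]
    split_ifs <;> push_cast <;> omega

/-- The distributions in the policy goal at which every student is matched and no school exceeds
its capacity, as integer vectors. -/
def goalVec (Ξ : Set (C × T → ℕ)) : Set (C × T → ℤ) := toInt '' (Ξ ∩ E.fullPolicy)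

lemma toInt_mem_goalVec {Ξ : Set (C × T → ℕ)} {ξ : C × T → ℕ} :
    toInt ξ ∈ E.goalVec Ξ ↔ ξ ∈ Ξ ∩ E.fullPolicy :=
  toInt_injective.mem_set_image

lemma weakExchange_goalVec {f : (C × T → ℕ) → ℝ} (hf : E.PseudoMConcave f) (l : ℝ) :
    WeakExchange (E.goalVec (funPolicy f l)) := by
  rintro _ ⟨ξ, ⟨hξ, hξ'⟩, rfl⟩ _ ⟨η, ⟨hη, hη'⟩, rfl⟩ hne
  obtain ⟨p, r, hp, hr, h1, h2, hmin⟩ := hf ξ hξ' η hη' fun h => hne (by rw [h])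
  have hl := (le_min hξ hη).trans hmin
  refine ⟨p, r, by simpa [toInt] using hp, by simpa [toInt] using hr, ?_, ?_⟩
  · rw [← toInt_exchange (by omega), toInt_mem_goalVec]
    exact ⟨hl.trans (min_le_left _ _), h1⟩
  · rw [← toInt_exchange (by omega), toInt_mem_goalVec]
    exact ⟨hl.trans (min_le_right _ _), h2⟩

lemma initial_mem_goalVec {f : (C × T → ℕ) → ℝ} {l : ℝ} (hl : l ≤ f (E.dist E.initial)) :
    toInt (E.dist E.initial) ∈ E.goalVec (funPolicy f l) := by
  rw [toInt_mem_goalVec]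
  refine ⟨hl, ?_⟩
  have := E.feasible_initial
  rw [initial_eq_graph] at this ⊢
  exact (E.feasible_graph_iff _).1 this

/-! ### States of the algorithm -/

variable (master : StrictPref S) (Ξ : Set (C × T → ℕ))
  (Q : S → StrictPref (C × T)) (σ : TTCState S C T)

/-- The pair that student `s` holds: the one assigned to her, or else her initial pair. -/
noncomputable def held (s : S) : C × T := (σ.assigned s).getD (E.initialPair s)

/-- The distribution of the current matching, as an integer vector. -/
noncomputable def curVec : C × T → ℤ := toInt (E.dist (E.currentMatching σ))

lemma currentMatching_eq_graph : E.currentMatching σ = graph fun s => (E.held σ s).1 := rfl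

/-- The properties of a state that hold throughout the algorithm. -/
structure Valid : Prop where
  weak : ∀ s p, σ.assigned s = some p → (Q s).weak p (E.initialPair s)
  mem : E.curVec σ ∈ E.goalVec Ξ
  remaining : ∀ s, σ.assigned s = none → E.initialPair s ∈ σ.remaining

/-- Every student ranks the pairs with a type other than her own below her initial pair. -/
def OwnTypeFirst : Prop :=
  ∀ s p, p.2 ≠ E.studentType s → (Q s).rel (E.initialPair s) p

variable {E master Ξ Q σ}

lemma OwnTypeFirst.snd_eq (hQ : E.OwnTypeFirst Q) {s : S} {p : C × T}
    (h : (Q s).weak p (E.initialPair s)) : p.2 = E.studentType s := by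
  by_contra hne
  exact (Q s).not_rel_of_weak h (hQ s p hne)

lemma Valid.held_weak (h : E.Valid Ξ Q σ) (s : S) :
    (Q s).weak (E.held σ s) (E.initialPair s) := by
  rw [held]
  rcases hs : σ.assigned s with _ | p
  · exact Or.inr rfl
  · exact h.weak s p hs

lemma held_of_none {s : S} (h : σ.assigned s = none) : E.held σ s = E.initialPair s := by
  rw [held, h]; rfl

lemma curVec_eq_countVec (hQ : E.OwnTypeFirst Q)
    (h : ∀ s, (Q s).weak (E.held σ s) (E.initialPair s)) :
    E.curVec σ = countVec (E.held σ) := by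
  rw [curVec, currentMatching_eq_graph, toInt_dist_graph]
  congr 1
  funext s
  rw [← hQ.snd_eq (h s)]

lemma dist_initialPair_pos {s : S} (h : σ.assigned s = none) :
    0 < E.dist (E.currentMatching σ) (E.initialPair s) := by
  classical
  rw [currentMatching_eq_graph, dist_graph, Finset.card_pos]
  exact ⟨s, by simp [held_of_none h, initialPair]⟩

lemma permissible_iff {s : S} {p : C × T} :
    E.Permissible Ξ σ s p ↔
      σ.assigned s = none ∧ move (E.curVec σ) (E.initialPair s) p ∈ E.goalVec Ξ := by
  refine and_congr_right fun h => ?_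
  rw [curVec, ← toInt_exchange (dist_initialPair_pos h), toInt_mem_goalVec]

lemma Valid.permissible_self (h : E.Valid Ξ Q σ) {s : S} (hs : σ.assigned s = none) :
    E.Permissible Ξ σ s (E.initialPair s) := by
  rw [permissible_iff, move_self]
  exact ⟨hs, h.mem⟩

lemma Valid.mem_remainingPairs (h : E.Valid Ξ Q σ) {s : S} (hs : σ.assigned s = none) :
    E.initialPair s ∈ E.remainingPairs Ξ σ :=
  ⟨h.remaining s hs, s, h.permissible_self hs⟩

/-! ### Pointing and cycles -/

lemma StudentPoints.unique {s : S} {p q : C × T} (hp : E.StudentPoints Ξ Q σ s p)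
    (hq : E.StudentPoints Ξ Q σ s q) : p = q := by
  by_contra hne
  exact (Q s).asymm (hp.2.2 q hq.2.1 (Ne.symm hne)) (hq.2.2 p hp.2.1 hne)

lemma Valid.exists_studentPoints (h : E.Valid Ξ Q σ) {s : S} (hs : σ.assigned s = none) :
    ∃ p, E.StudentPoints Ξ Q σ s p := by
  obtain ⟨p, hp, hp'⟩ := (Q s).exists_top ⟨_, h.mem_remainingPairs hs⟩
  exact ⟨p, hs, hp, hp'⟩

lemma HigherPriority.asymm {p : C × T} {s s' : S} (h : E.HigherPriority master p s s') :
    ¬ E.HigherPriority master p s' s := by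
  have := master.asymm (a := s) (b := s')
  unfold HigherPriority at *
  tauto

lemma HigherPriority.trans {p : C × T} {a b c : S} (h : E.HigherPriority master p a b)
    (h' : E.HigherPriority master p b c) : E.HigherPriority master p a c := by
  have := master.trans a b c
  unfold HigherPriority at *
  tauto

lemma HigherPriority.total (p : C × T) {a b : S} (h : a ≠ b) :
    E.HigherPriority master p a b ∨ E.HigherPriority master p b a := by
  have := master.total a b h
  unfold HigherPriority
  tauto

variable (E master) in
/-- The priority order at a pair. -/
def priority (p : C × T) : StrictPref S where
  rel := E.HigherPriority master p
  irrefl _ h := h.asymm h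
  trans _ _ _ := HigherPriority.trans
  total _ _ := HigherPriority.total p

lemma PairPoints.unique {p : C × T} {s t : S} (hs : E.PairPoints master Ξ σ p s)
    (ht : E.PairPoints master Ξ σ p t) : s = t := by
  by_contra hne
  exact (hs.2.2 t ht.2.1 (Ne.symm hne)).asymm (ht.2.2 s hs.2.1 hne)

lemma exists_pairPoints {p : C × T} (hp : p ∈ E.remainingPairs Ξ σ) :
    ∃ s, E.PairPoints master Ξ σ p s := by
  obtain ⟨s, hs, hs'⟩ := (E.priority master p).exists_top (s := {s | E.Permissible Ξ σ s p}) hp.2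
  exact ⟨s, hp, hs, fun t ht => hs' t ht⟩

lemma PointsVia.unique {s t u : S} (ht : E.PointsVia master Ξ Q σ s t)
    (hu : E.PointsVia master Ξ Q σ s u) : t = u := by
  obtain ⟨p, hp, hp'⟩ := ht
  obtain ⟨q, hq, hq'⟩ := hu
  cases hp.unique hq
  exact hp'.unique hq'

lemma InCycle.exists_pointsVia {s : S} (h : E.InCycle master Ξ Q σ s) :
    ∃ t, E.PointsVia master Ξ Q σ s t ∧ E.InCycle master Ξ Q σ t := by
  obtain ⟨t, h1, h2⟩ := Relation.TransGen.head'_iff.1 h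
  exact ⟨t, h1, Relation.TransGen.tail'_iff.2 ⟨s, h2, h1⟩⟩

lemma InCycle.exists_pointsVia_to {s : S} (h : E.InCycle master Ξ Q σ s) :
    ∃ t, E.PointsVia master Ξ Q σ t s ∧ E.InCycle master Ξ Q σ t := by
  obtain ⟨t, h1, h2⟩ := Relation.TransGen.tail'_iff.1 h
  exact ⟨t, h2, Relation.TransGen.head'_iff.2 ⟨s, h2, h1⟩⟩

/-- As every student points to at most one other, whoever is reached from a cycle lies on it. -/
lemma InCycle.of_reflTransGen {s t : S} (h : E.InCycle master Ξ Q σ s)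
    (hst : Relation.ReflTransGen (E.PointsVia master Ξ Q σ) s t) : E.InCycle master Ξ Q σ t := by
  induction hst with
  | refl => exact h
  | tail _ hbc ih =>
    obtain ⟨d, h1, h2⟩ := InCycle.exists_pointsVia ih
    rwa [h1.unique hbc] at h2

lemma InCycle.unassigned {s : S} (h : E.InCycle master Ξ Q σ s) : σ.assigned s = none := by
  obtain ⟨t, ⟨p, hp, _⟩, _⟩ := h.exists_pointsVia
  exact hp.1

/-! ### One step of the algorithm -/

lemma step_assigned_of_inCycle {s : S} {p : C × T} (h : E.InCycle master Ξ Q σ s)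
    (hp : E.StudentPoints Ξ Q σ s p) : (E.step master Ξ Q σ).assigned s = some p := by
  have h' : E.InCycle master Ξ Q σ s ∧ ∃ p, E.StudentPoints Ξ Q σ s p := ⟨h, p, hp⟩
  simp only [step]
  rw [dif_pos h', h'.2.choose_spec.unique hp]

lemma step_assigned_of_not_inCycle {s : S} (h : ¬ E.InCycle master Ξ Q σ s) :
    (E.step master Ξ Q σ).assigned s = σ.assigned s := by
  simp only [step]
  rw [dif_neg fun h' => h h'.1]

lemma step_assigned_some {s : S} {p : C × T} (h : σ.assigned s = some p) :
    (E.step master Ξ Q σ).assigned s = some p := by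
  rw [step_assigned_of_not_inCycle, h]
  intro h'
  simp [h'.unassigned] at h

lemma step_assigned_none {s : S} (h : (E.step master Ξ Q σ).assigned s = none) :
    σ.assigned s = none ∧ ¬ E.InCycle master Ξ Q σ s := by
  have hc : ¬ E.InCycle master Ξ Q σ s := fun h' => by
    obtain ⟨t, ⟨p, hp, _⟩, _⟩ := h'.exists_pointsVia
    simp [step_assigned_of_inCycle h' hp] at h
  exact ⟨step_assigned_of_not_inCycle hc ▸ h, hc⟩

/-- A student who becomes assigned receives the pair that she points to. -/
lemma studentPoints_of_step_assigned {s : S} {p : C × T} (h : σ.assigned s = none)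
    (hp : (E.step master Ξ Q σ).assigned s = some p) :
    E.InCycle master Ξ Q σ s ∧ E.StudentPoints Ξ Q σ s p := by
  have hc : E.InCycle master Ξ Q σ s := by
    by_contra hc
    simp [step_assigned_of_not_inCycle hc, h] at hp
  obtain ⟨t, ⟨q, hq, _⟩, _⟩ := hc.exists_pointsVia
  rw [step_assigned_of_inCycle hc hq] at hp
  exact ⟨hc, Option.some.inj hp ▸ hq⟩

/-- Otherwise reachability in the pointing graph is a strict order on the finite set of students, and
a student who reaches nobody contradicts that every unassigned student points somewhere. -/
lemma Valid.exists_inCycle (h : E.Valid Ξ Q σ) (hs : ∃ s, σ.assigned s = none) :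
    ∃ s, E.InCycle master Ξ Q σ s := by
  by_contra! hno
  let R := Function.swap (Relation.TransGen (E.PointsVia master Ξ Q σ))
  have : IsTrans S R := ⟨fun a b c h1 h2 => Relation.TransGen.trans h2 h1⟩
  have : Std.Irrefl R := ⟨hno⟩
  obtain ⟨s, hs, hmin⟩ := (Finite.wellFounded_of_trans_of_irrefl R).has_min _ hs
  obtain ⟨p, hp⟩ := h.exists_studentPoints hs
  obtain ⟨t, ht⟩ := exists_pairPoints (master := master) hp.2.1
  exact hmin t ht.2.1.1 (Relation.TransGen.single ⟨p, hp, ht⟩)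

/-- A pair that points to a student who is not initially matched with it cannot be given a unit
from a student with higher master priority. -/
lemma PairPoints.move_notMem {p : C × T} {s t : S} (hs : E.PairPoints master Ξ σ p s)
    (hne : p ≠ E.initialPair s) (ht : σ.assigned t = none) (hts : master.rel t s) :
    move (E.curVec σ) (E.initialPair t) p ∉ E.goalVec Ξ := by
  intro hmem
  have hst : t ≠ s := by rintro rfl; exact master.irrefl _ hts
  rcases hs.2.2 t (permissible_iff.2 ⟨ht, hmem⟩) hst with h | h
  · exact hne h.1.symm
  · exact master.asymm hts h.2

/-- In one step the distribution changes by the simultaneous moves `initialPair s → y s`, where `s`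
ranges over the students in cycles for whom this is not a trivial move, and `y s` is the pair that
points to `s` in the cycle. -/
lemma Valid.exists_step_eq (hQ : E.OwnTypeFirst Q) (h : E.Valid Ξ Q σ) :
    ∃ (y : S → C × T) (K : Finset S),
      (∀ s ∈ K, E.InCycle master Ξ Q σ s ∧ y s ≠ E.initialPair s ∧
        E.PairPoints master Ξ σ (y s) s) ∧
      (∀ s p, (E.step master Ξ Q σ).assigned s = some p → (Q s).weak p (E.initialPair s)) ∧
      E.curVec (E.step master Ξ Q σ) = moveAll (E.curVec σ) E.initialPair y K := by
  classical
  have hweak : ∀ s p, (E.step master Ξ Q σ).assigned s = some p →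
      (Q s).weak p (E.initialPair s) := by
    intro s p hp
    rcases hs : σ.assigned s with _ | q
    · have hsp := (studentPoints_of_step_assigned hs hp).2
      by_cases hne : E.initialPair s = p
      · exact Or.inr hne.symm
      · exact Or.inl (hsp.2.2 _ (h.mem_remainingPairs hs) hne)
    · rw [step_assigned_some hs] at hp
      exact h.weak s p (hs.trans hp)
  have hweak' : ∀ s, (Q s).weak (E.held (E.step master Ξ Q σ) s) (E.initialPair s) := by
    intro s
    rw [held]
    rcases hs : (E.step master Ξ Q σ).assigned s with _ | p
    · exact Or.inr rfl
    · exact hweak s p hs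
  -- the successor map permutes the students in cycles
  let K₀ := {s // E.InCycle master Ξ Q σ s}
  have hnext : ∀ s : K₀, ∃ t : K₀, E.PointsVia master Ξ Q σ s t := fun s => by
    obtain ⟨t, h1, h2⟩ := InCycle.exists_pointsVia s.2
    exact ⟨⟨t, h2⟩, h1⟩
  choose nx hnx using hnext
  have hsurj : Function.Surjective nx := fun t => by
    obtain ⟨s, h1, h2⟩ := InCycle.exists_pointsVia_to t.2
    exact ⟨⟨s, h2⟩, Subtype.ext ((hnx ⟨s, h2⟩).unique h1)⟩
  let e : K₀ ≃ K₀ := Equiv.ofBijective nx (Finite.injective_iff_bijective.1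
    (Finite.injective_iff_surjective.2 hsurj))
  choose pt hpt1 hpt2 using hnx
  let y : S → C × T := fun s => if hs : E.InCycle master Ξ Q σ s then pt (e.symm ⟨s, hs⟩) else
    E.initialPair s
  have hy : ∀ s : K₀, y s = pt (e.symm s) := fun s => dif_pos s.2
  have hyp : ∀ s : K₀, E.PairPoints master Ξ σ (y s) s := fun s => by
    have h1 := hpt2 (e.symm s)
    have h2 : nx (e.symm s) = s := e.apply_symm_apply s
    rw [hy]
    rwa [h2] at h1
  refine ⟨y, Finset.univ.filter fun s => E.InCycle master Ξ Q σ s ∧ y s ≠ E.initialPair s,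
    fun s hs => ?_, hweak, ?_⟩
  · have hs' := (Finset.mem_filter.1 hs).2
    exact ⟨hs'.1, hs'.2, hyp ⟨s, hs'.1⟩⟩
  · rw [curVec_eq_countVec hQ hweak', curVec_eq_countVec hQ h.held_weak, moveAll,
      ← sub_eq_iff_eq_add', countVec, countVec, ← Finset.sum_sub_distrib]
    have hsub : ∀ g : S → C × T → ℤ, (∀ s, ¬ E.InCycle master Ξ Q σ s → g s = 0) →
        ∑ s, g s = ∑ s : K₀, g s := fun g hg => by
      rw [← Finset.sum_subset (Finset.subset_univ
        (Finset.univ.filter fun s => E.InCycle master Ξ Q σ s))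
        fun s _ hs => hg s (by simpa using hs)]
      exact (Finset.sum_subtype _ (by simp) _)
    rw [hsub]
    · have h1 : ∀ s : K₀, E.held (E.step master Ξ Q σ) s = pt s := fun s => by
        rw [held, step_assigned_of_inCycle s.2 (hpt1 s)]; rfl
      have h2 : ∀ s : K₀, E.held σ s = E.initialPair s := fun s => held_of_none s.2.unassigned
      simp only [h1, h2]
      rw [Finset.sum_filter, hsub]
      · rw [Finset.sum_sub_distrib, ← Equiv.sum_comp e.symm, ← Finset.sum_sub_distrib]
        refine Finset.sum_congr rfl fun s _ => ?_
        rw [← hy s]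
        by_cases hne : y s = E.initialPair s
        · simp [hne]
        · rw [if_pos ⟨s.2, hne⟩]
      · intro s hs
        rw [if_neg fun h => hs h.1]
    · intro s hs
      rw [held, held, step_assigned_of_not_inCycle hs, sub_self]

lemma triangular_of_pairPoints {y : S → C × T} {K : Finset S}
    (hK : ∀ s ∈ K, y s ≠ E.initialPair s ∧ E.PairPoints master Ξ σ (y s) s) :
    Triangular (E.goalVec Ξ) master.rel (E.curVec σ) E.initialPair y K :=
  ⟨fun k hk => (permissible_iff.1 (hK k hk).2.2.1).2,
    fun k hk j hj hjk => (hK k hk).2.move_notMem (hK k hk).1 (hK j hj).2.2.1.1 hjk⟩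

lemma Valid.step (hB : WeakExchange (E.goalVec Ξ)) (hQ : E.OwnTypeFirst Q) (h : E.Valid Ξ Q σ) :
    E.Valid Ξ Q (E.step master Ξ Q σ) := by
  obtain ⟨y, K, hK, hweak, heq⟩ := h.exists_step_eq (master := master) hQ
  refine ⟨hweak, ?_, fun s hs => h.mem_remainingPairs (step_assigned_none hs).1⟩
  rw [heq]
  exact (hB.moveAll_mem_and_iff master h.mem K
    (triangular_of_pairPoints fun s hs => (hK s hs).2)).1

/-- A pair keeps pointing to the same student until she is assigned. -/
lemma PairPoints.step (hB : WeakExchange (E.goalVec Ξ)) (hQ : E.OwnTypeFirst Q)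
    (h : E.Valid Ξ Q σ) {p : C × T} {s : S} (hp : E.PairPoints master Ξ σ p s)
    (hs : ¬ E.InCycle master Ξ Q σ s) : E.PairPoints master Ξ (E.step master Ξ Q σ) p s := by
  classical
  have hs1 : (E.step master Ξ Q σ).assigned s = none :=
    (step_assigned_of_not_inCycle hs).trans hp.2.1.1
  suffices H : E.Permissible Ξ (E.step master Ξ Q σ) s p ∧
      ∀ t, E.Permissible Ξ (E.step master Ξ Q σ) t p → t ≠ s → E.HigherPriority master p s t from
    ⟨⟨hp.1, s, H.1⟩, H.1, H.2⟩
  by_cases hps : p = E.initialPair s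
  · subst hps
    refine ⟨(h.step hB hQ).permissible_self hs1, fun t ht hts => ?_⟩
    by_cases htp : E.initialPair t = E.initialPair s
    · exact hp.2.2 t (htp ▸ h.permissible_self (step_assigned_none ht.1).1) hts
    · exact Or.inl ⟨rfl, htp⟩
  · obtain ⟨y, K, hK, -, heq⟩ := h.exists_step_eq (master := master) hQ
    have hsK : s ∉ K := fun hmem => hs (hK s hmem).1
    have htri := triangular_of_pairPoints fun k hk => (hK k hk).2
    refine ⟨permissible_iff.2 ⟨hs1, ?_⟩, fun t ht hts => ?_⟩
    · -- the move of `s` to `p` can be added to the moves that are executed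
      have htri' : Triangular (E.goalVec Ξ) master.rel (E.curVec σ) E.initialPair
          (Function.update y s p) (insert s K) := triangular_of_pairPoints fun k hk => by
        by_cases hks : k = s
        · subst hks; simpa using ⟨hps, hp⟩
        · rw [Function.update_of_ne hks]
          exact (hK k ((Finset.mem_insert.1 hk).resolve_left hks)).2
      have hmem := (hB.moveAll_mem_and_iff master h.mem _ htri').1
      rw [moveAll_insert _ hsK, Function.update_self] at hmem
      rw [heq]
      convert hmem using 2
      simp only [moveAll]
      congr 1
      refine Finset.sum_congr rfl fun k hk => ?_
      rw [Function.update_of_ne (by rintro rfl; exact hsK hk)]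
    · have htn := (step_assigned_none ht.1).1
      by_cases htp : E.Permissible Ξ σ t p
      · exact hp.2.2 t htp hts
      · have hnot : move (E.curVec σ) (E.initialPair t) p ∉ E.goalVec Ξ :=
          fun hm => htp (permissible_iff.2 ⟨htn, hm⟩)
        rcases master.total s t (Ne.symm hts) with hst | hst
        · have htp' : E.initialPair t ≠ p := by
            rintro rfl; exact hnot (by simpa using h.mem)
          exact Or.inr ⟨iff_of_false (Ne.symm hps) htp', hst⟩
        · refine absurd (permissible_iff.1 ht).2 ?_
          rw [heq]
          exact hB.moveAll_notMem master h.mem htri hsK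
            (fun k hk hks => hp.move_notMem hps (hK k hk).1.unassigned hks)
            (fun k hk hsk => (hK k hk).2.2.move_notMem (hK k hk).2.1 htn
              (master.trans _ _ _ hst hsk)) hnot

/-! ### Termination -/

lemma stateAfter_succ (n : ℕ) :
    E.stateAfter master Ξ Q (n + 1) = E.step master Ξ Q (E.stateAfter master Ξ Q n) :=
  Function.iterate_succ_apply' _ _ _

lemma valid_stateAfter (hB : WeakExchange (E.goalVec Ξ)) (hQ : E.OwnTypeFirst Q)
    (h0 : toInt (E.dist E.initial) ∈ E.goalVec Ξ) (n : ℕ) :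
    E.Valid Ξ Q (E.stateAfter master Ξ Q n) := by
  induction n with
  | zero =>
    refine ⟨fun s p h => by simp [stateAfter, initState] at h, ?_, fun s _ => trivial⟩
    rwa [initial_eq_graph] at h0
  | succ n ih => rw [stateAfter_succ]; exact ih.step hB hQ

lemma stateAfter_assigned_mono {s : S} {p : C × T} {n m : ℕ} (hnm : n ≤ m)
    (h : (E.stateAfter master Ξ Q n).assigned s = some p) :
    (E.stateAfter master Ξ Q m).assigned s = some p := by
  induction m, hnm using Nat.le_induction with
  | base => exact h
  | succ m _ ih => rw [stateAfter_succ]; exact step_assigned_some ih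

lemma stateAfter_remaining_anti {n m : ℕ} (hnm : n ≤ m) :
    (E.stateAfter master Ξ Q m).remaining ⊆ (E.stateAfter master Ξ Q n).remaining := by
  induction m, hnm using Nat.le_induction with
  | base => exact subset_rfl
  | succ m _ ih => rw [stateAfter_succ]; exact fun p hp => ih hp.1

lemma exists_all_assigned (hB : WeakExchange (E.goalVec Ξ)) (hQ : E.OwnTypeFirst Q)
    (h0 : toInt (E.dist E.initial) ∈ E.goalVec Ξ) :
    ∃ n, ∀ s, (E.stateAfter master Ξ Q n).assigned s ≠ none := by
  classical
  have key : ∀ n, (Finset.univ.filter fun s =>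
      (E.stateAfter master Ξ Q n).assigned s = none).card ≤ Fintype.card S - n := by
    intro n
    induction n with
    | zero => exact Finset.card_le_univ _
    | succ n ih =>
      have hsub : (Finset.univ.filter fun s => (E.stateAfter master Ξ Q (n + 1)).assigned s = none)
          ⊆ Finset.univ.filter fun s => (E.stateAfter master Ξ Q n).assigned s = none := by
        intro s hs
        simp only [Finset.mem_filter, Finset.mem_univ, true_and, stateAfter_succ] at hs ⊢
        exact (step_assigned_none hs).1
      by_cases hex : ∃ s, (E.stateAfter master Ξ Q n).assigned s = none
      · obtain ⟨s, hs⟩ := (valid_stateAfter hB hQ h0 n).exists_inCycle (master := master) hex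
        have hlt := Finset.card_lt_card (hsub.ssubset_of_ne fun heq => by
          have hmem : s ∈ Finset.univ.filter fun s =>
              (E.stateAfter master Ξ Q n).assigned s = none := by simpa using hs.unassigned
          rw [← heq, Finset.mem_filter, stateAfter_succ] at hmem
          exact (step_assigned_none hmem.2).2 hs)
        omega
      · have := Finset.card_le_card hsub
        have hempty : (Finset.univ.filter fun s =>
            (E.stateAfter master Ξ Q n).assigned s = none) = ∅ :=
          Finset.filter_eq_empty_iff.2 fun s _ hs => hex ⟨s, hs⟩
        rw [hempty, Finset.card_empty] at this
        omega
  refine ⟨Fintype.card S, fun s hs => ?_⟩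
  have h := key (Fintype.card S)
  rw [Nat.sub_self, Nat.le_zero, Finset.card_eq_zero] at h
  exact Finset.notMem_empty s (h ▸ by simpa using hs)

variable (E master Ξ Q) in
/-- A complete run of the algorithm: student `s` is assigned the pair `g s` in the step that is
applied to the state after `n s` steps. -/
structure IsRun (g : S → C × T) (n : S → ℕ) : Prop where
  before : ∀ s, (E.stateAfter master Ξ Q (n s)).assigned s = none
  after : ∀ s, (E.stateAfter master Ξ Q (n s + 1)).assigned s = some (g s)

lemma exists_isRun (hB : WeakExchange (E.goalVec Ξ)) (hQ : E.OwnTypeFirst Q)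
    (h0 : toInt (E.dist E.initial) ∈ E.goalVec Ξ) : ∃ g n, E.IsRun master Ξ Q g n := by
  classical
  obtain ⟨N, hN⟩ := exists_all_assigned (master := master) hB hQ h0
  have h : ∀ s, ∃ p n, (E.stateAfter master Ξ Q n).assigned s = none ∧
      (E.stateAfter master Ξ Q (n + 1)).assigned s = some p := fun s => by
    have hex : ∃ k, (E.stateAfter master Ξ Q k).assigned s ≠ none := ⟨N, hN s⟩
    rcases hk : Nat.find hex with _ | k
    · have := Nat.find_spec hex
      rw [hk] at this
      exact absurd rfl this
    · have h1 := Nat.find_spec hex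
      rw [hk] at h1
      obtain ⟨p, hp⟩ := Option.ne_none_iff_exists'.1 h1
      exact ⟨p, k, not_not.1 (Nat.find_min hex (by omega)), hp⟩
  choose g n h1 h2 using h
  exact ⟨g, n, h1, h2⟩

namespace IsRun

variable {g : S → C × T} {n : S → ℕ}

lemma assigned_of_lt (h : E.IsRun master Ξ Q g n) {s : S} {k : ℕ} (hk : n s < k) :
    (E.stateAfter master Ξ Q k).assigned s = some (g s) :=
  stateAfter_assigned_mono hk (h.after s)

lemma assigned_of_le (h : E.IsRun master Ξ Q g n) {s : S} {k : ℕ} (hk : k ≤ n s) :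
    (E.stateAfter master Ξ Q k).assigned s = none := by
  rcases hs : (E.stateAfter master Ξ Q k).assigned s with _ | p
  · rfl
  · have := stateAfter_assigned_mono hk hs
    rw [h.before] at this
    exact absurd this (by simp)

lemma inCycle (h : E.IsRun master Ξ Q g n) (s : S) :
    E.InCycle master Ξ Q (E.stateAfter master Ξ Q (n s)) s :=
  (studentPoints_of_step_assigned (h.before s) (stateAfter_succ (E := E) (n s) ▸ h.after s)).1

lemma studentPoints (h : E.IsRun master Ξ Q g n) (s : S) :
    E.StudentPoints Ξ Q (E.stateAfter master Ξ Q (n s)) s (g s) :=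
  (studentPoints_of_step_assigned (h.before s) (stateAfter_succ (E := E) (n s) ▸ h.after s)).2

lemma not_inCycle (h : E.IsRun master Ξ Q g n) {s : S} {k : ℕ} (hk : k < n s) :
    ¬ E.InCycle master Ξ Q (E.stateAfter master Ξ Q k) s := by
  have := h.assigned_of_le (s := s) (k := k + 1) hk
  rw [stateAfter_succ] at this
  exact (step_assigned_none this).2

lemma ttcOutcome_eq (h : E.IsRun master Ξ Q g n) :
    E.ttcOutcome master Ξ Q = graph fun s => (g s).1 := by
  ext ⟨s, c⟩
  rw [mem_graph]
  constructor
  · rintro ⟨k, t, hk⟩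
    have h1 := stateAfter_assigned_mono (le_max_left k (n s + 1)) hk
    rw [h.assigned_of_lt (by change n s < _; omega)] at h1
    simpa using (congrArg Prod.fst (Option.some.inj h1)).symm
  · rintro rfl
    exact ⟨n s + 1, (g s).2, h.after s⟩

/-- The outcome is the current matching once everyone is assigned, so it satisfies the goal. -/
lemma dist_mem (hB : WeakExchange (E.goalVec Ξ)) (hQ : E.OwnTypeFirst Q)
    (h0 : toInt (E.dist E.initial) ∈ E.goalVec Ξ) (h : E.IsRun master Ξ Q g n) :
    E.dist (graph fun s => (g s).1) ∈ Ξ ∩ E.fullPolicy := by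
  obtain ⟨N, hN⟩ := exists_all_assigned (master := master) hB hQ h0
  have hmem := (valid_stateAfter (master := master) hB hQ h0 N).mem
  rw [curVec, toInt_mem_goalVec, currentMatching_eq_graph] at hmem
  have hg : ∀ s, E.held (E.stateAfter master Ξ Q N) s = g s := fun s => by
    rw [held, h.assigned_of_lt (lt_of_not_ge fun hle => hN s (h.assigned_of_le hle))]
    rfl
  simpa only [hg] using hmem

lemma weak_initialPair (hB : WeakExchange (E.goalVec Ξ)) (hQ : E.OwnTypeFirst Q)
    (h0 : toInt (E.dist E.initial) ∈ E.goalVec Ξ) (h : E.IsRun master Ξ Q g n) (s : S) :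
    (Q s).weak (g s) (E.initialPair s) :=
  (valid_stateAfter hB hQ h0 _).weak s _ (h.after s)

end IsRun

/-! ### Constrained efficiency -/

lemma exists_of_countVec_lt {S V : Type*} [Fintype S] {z w : S → V} {r : V}
    (h : countVec z r < countVec w r) : ∃ t, w t = r ∧ z t ≠ r := by
  classical
  by_contra! hno
  refine h.not_ge ?_
  rw [countVec_apply, countVec_apply]
  refine Finset.sum_le_sum fun t _ => ?_
  by_cases hw : w t = r
  · simp [hw, hno t hw]
  · rw [if_neg hw]; split_ifs <;> simp

lemma exists_of_countVec_le {S V : Type*} [Fintype S] {z w : S → V} {r : V}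
    (h : countVec z r ≤ countVec w r) {s : S} (hz : z s = r) (hw : w s ≠ r) :
    ∃ t, w t = r ∧ z t ≠ r := by
  classical
  by_contra! hno
  refine h.not_gt ?_
  rw [countVec_apply, countVec_apply]
  refine Finset.sum_lt_sum (fun t _ => ?_) ⟨s, Finset.mem_univ _, ?_⟩
  · by_cases hw : w t = r
    · simp [hw, hno t hw]
    · rw [if_neg hw]; split_ifs <;> simp
  · simp [hz, hw]

lemma exists_no_permissible_of_notMem {p : C × T} {k : ℕ}
    (h : p ∉ E.remainingPairs Ξ (E.stateAfter master Ξ Q k)) :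
    ∃ m ≤ k, ∀ t, ¬ E.Permissible Ξ (E.stateAfter master Ξ Q m) t p := by
  by_contra! hno
  have hrem : ∀ m ≤ k, p ∈ (E.stateAfter master Ξ Q m).remaining := fun m => by
    induction m with
    | zero => intro _; trivial
    | succ m ih => intro hm; rw [stateAfter_succ]; exact ⟨ih (by omega), hno m (by omega)⟩
  exact h ⟨hrem k le_rfl, hno k le_rfl⟩

/-- No assignment of pairs that satisfies the goal is weakly better for everybody. Otherwise, take
the first step in which a student `s` gets a pair other than `z s`. The pair `z s` was removed
by then, in a state at which the two assignments agree on all assigned students; an exchange between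
the distributions yields an unassigned student who was permissible to it. -/
lemma IsRun.eq_of_weak (hB : WeakExchange (E.goalVec Ξ)) (hQ : E.OwnTypeFirst Q)
    (h0 : toInt (E.dist E.initial) ∈ E.goalVec Ξ) {g : S → C × T} {n : S → ℕ}
    (h : E.IsRun master Ξ Q g n) {z : S → C × T}
    (hz : countVec z ∈ E.goalVec Ξ) (hw : ∀ s, (Q s).weak (z s) (g s)) : z = g := by
  classical
  by_contra hne
  obtain ⟨s, hs, hmin⟩ : ∃ s, z s ≠ g s ∧ ∀ t, z t ≠ g t → n s ≤ n t := by
    obtain ⟨s₀, hs₀⟩ := Function.ne_iff.1 hne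
    obtain ⟨s, hs, hmin⟩ := Finset.exists_min_image (Finset.univ.filter fun s => z s ≠ g s) n
      ⟨s₀, by simpa using hs₀⟩
    exact ⟨s, by simpa using hs, fun t ht => hmin t (by simpa using ht)⟩
  have hrel : (Q s).rel (z s) (g s) := (hw s).resolve_right hs
  obtain ⟨m, hm, hno⟩ := exists_no_permissible_of_notMem (fun hmem =>
    (Q s).asymm hrel ((h.studentPoints s).2.2 (z s) hmem hs))
  set σ := E.stateAfter master Ξ Q m
  have hσ : E.Valid Ξ Q σ := valid_stateAfter hB hQ h0 m
  -- a student whose held pair differs from her pair in `z` is unassigned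
  have hun : ∀ t, z t ≠ E.held σ t → σ.assigned t = none := fun t ht => by
    by_contra hsome
    have hlt : n t < m := lt_of_not_ge fun hle => hsome (h.assigned_of_le hle)
    have hzt : z t = g t := by
      by_contra hzt
      exact (hmin t hzt).not_gt (hlt.trans_le hm)
    exact ht (by rw [held, h.assigned_of_lt hlt, hzt]; rfl)
  have hcur := curVec_eq_countVec hQ hσ.held_weak
  by_cases hlt : E.curVec σ (z s) < countVec z (z s)
  · obtain ⟨r, hr, hr'⟩ := hB.exists_move_to hσ.mem hz hlt
    rw [hcur] at hr
    obtain ⟨t, ht, ht'⟩ := exists_of_countVec_lt hr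
    have htn := hun t (by rw [ht]; exact ht')
    refine hno t (permissible_iff.2 ⟨htn, ?_⟩)
    rw [← held_of_none htn, ht]
    exact hr'
  · have hsn : σ.assigned s = none := h.assigned_of_le hm
    obtain ⟨t, htn, ht⟩ : ∃ t, σ.assigned t = none ∧ E.initialPair t = z s := by
      by_cases hsi : E.held σ s = z s
      · exact ⟨s, hsn, by rw [← hsi, held_of_none hsn]⟩
      · rw [hcur, not_lt] at hlt
        obtain ⟨t, ht, ht'⟩ := exists_of_countVec_le hlt rfl hsi
        have htn := hun t (by rw [ht]; exact ht')
        exact ⟨t, htn, by rw [← ht, held_of_none htn]⟩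
    exact hno t (ht ▸ hσ.permissible_self htn)

/-! ### Strategy-proofness -/

section Deviation

variable {Q' : S → StrictPref (C × T)} {s : S} {σ : TTCState S C T}

lemma PointsVia.congr (hQQ : ∀ u ≠ s, Q u = Q' u) {u v : S} (hu : u ≠ s)
    (h : E.PointsVia master Ξ Q σ u v) : E.PointsVia master Ξ Q' σ u v := by
  obtain ⟨p, hp, hp'⟩ := h
  exact ⟨p, ⟨hp.1, hp.2.1, hQQ u hu ▸ hp.2.2⟩, hp'⟩

lemma InCycle.congr (hQQ : ∀ u ≠ s, Q u = Q' u) (hs : ¬ E.InCycle master Ξ Q σ s) {u : S}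
    (h : E.InCycle master Ξ Q σ u) : E.InCycle master Ξ Q' σ u := by
  have hne : ∀ {v}, Relation.ReflTransGen (E.PointsVia master Ξ Q σ) u v → v ≠ s := by
    rintro v hv rfl
    exact hs (h.of_reflTransGen hv)
  have key : ∀ w, Relation.TransGen (E.PointsVia master Ξ Q σ) u w →
      Relation.TransGen (E.PointsVia master Ξ Q' σ) u w := by
    intro w hw
    induction hw with
    | single h1 => exact .single (h1.congr hQQ (hne .refl))
    | tail h1 h2 ih => exact ih.tail (h2.congr hQQ (hne h1.to_reflTransGen))
  exact key u h

/-- The report of a student who is in no cycle does not affect the step. -/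
lemma step_congr (hQQ : ∀ u ≠ s, Q u = Q' u) (hs : ¬ E.InCycle master Ξ Q σ s)
    (hs' : ¬ E.InCycle master Ξ Q' σ s) : E.step master Ξ Q σ = E.step master Ξ Q' σ := by
  have hQQ' : ∀ u ≠ s, Q' u = Q u := fun u hu => (hQQ u hu).symm
  have hassigned : (E.step master Ξ Q σ).assigned = (E.step master Ξ Q' σ).assigned := by
    funext u
    by_cases hu : E.InCycle master Ξ Q σ u
    · obtain ⟨v, ⟨p, hp, hpv⟩, -⟩ := hu.exists_pointsVia
      have hus : u ≠ s := by rintro rfl; exact hs hu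
      rw [step_assigned_of_inCycle hu hp, step_assigned_of_inCycle (hu.congr hQQ hs)
        ⟨hp.1, hp.2.1, hQQ u hus ▸ hp.2.2⟩]
    · rw [step_assigned_of_not_inCycle hu,
        step_assigned_of_not_inCycle fun hu' => hu (hu'.congr hQQ' hs')]
  change TTCState.mk (E.step master Ξ Q σ).assigned (E.remainingPairs Ξ σ) =
    TTCState.mk (E.step master Ξ Q' σ).assigned (E.remainingPairs Ξ σ)
  rw [hassigned]

/-- The pair `p` is on offer to student `s`: the pointing graph has a path from `p` to `s`, so that
`s` would be in a cycle if she pointed to `p`. -/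
def Offered (E : Problem S D C T) (master : StrictPref S) (Ξ : Set (C × T → ℕ))
    (Q : S → StrictPref (C × T)) (σ : TTCState S C T) (s : S) (p : C × T) : Prop :=
  ∃ u, E.PairPoints master Ξ σ p u ∧ Relation.ReflTransGen (E.PointsVia master Ξ Q σ) u s

/-- A path to `s` persists until `s` is assigned, as nobody on it is assigned before. -/
lemma Offered.step (hB : WeakExchange (E.goalVec Ξ)) (hQ : E.OwnTypeFirst Q)
    (h : E.Valid Ξ Q σ) {p : C × T} (hp : E.Offered master Ξ Q σ s p)
    (hs : ¬ E.InCycle master Ξ Q σ s) :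
    E.Offered master Ξ Q (E.step master Ξ Q σ) s p := by
  have hnot : ∀ {v}, Relation.ReflTransGen (E.PointsVia master Ξ Q σ) v s →
      ¬ E.InCycle master Ξ Q σ v := fun hv hc => hs (hc.of_reflTransGen hv)
  obtain ⟨u, hpu, hus⟩ := hp
  refine ⟨u, hpu.step hB hQ h (hnot hus), ?_⟩
  clear hpu
  induction hus using Relation.ReflTransGen.head_induction_on with
  | refl => exact .refl
  | head h1 h2 ih =>
    refine .head ?_ ih
    have hc := hnot (.head h1 h2)
    obtain ⟨q, hq, hq'⟩ := h1
    have hq2 := hq'.step hB hQ h (hnot h2)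
    exact ⟨q, ⟨(step_assigned_of_not_inCycle hc).trans hq.1, hq2.1,
      fun r hr hrq => hq.2.2 r hr.1 hrq⟩, hq2⟩

/-- In a cycle of the market with another report of `s`, the pair that she points to is offered to
her whatever she reports. -/
lemma InCycle.offered_congr (hQQ : ∀ u ≠ s, Q' u = Q u) {p : C × T}
    (h : E.InCycle master Ξ Q' σ s) (hp : E.StudentPoints Ξ Q' σ s p) :
    E.Offered master Ξ Q σ s p := by
  obtain ⟨u, ⟨q, hq, hqu⟩, hus⟩ := Relation.TransGen.head'_iff.1 h
  cases hp.unique hq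
  refine ⟨u, hqu, ?_⟩
  clear hqu
  induction hus using Relation.ReflTransGen.head_induction_on with
  | refl => exact .refl
  | @head b c h1 h2 ih =>
    by_cases hb : b = s
    · subst hb; exact .refl
    · exact .head (h1.congr hQQ hb) ih

/-- A student does not gain by deviating from `Q s` to `Q' s`. -/
lemma IsRun.not_rel_of_deviation (hB : WeakExchange (E.goalVec Ξ)) (hQ : E.OwnTypeFirst Q)
    (h0 : toInt (E.dist E.initial) ∈ E.goalVec Ξ) (hQQ : ∀ u ≠ s, Q' u = Q u)
    {g g' : S → C × T} {n n' : S → ℕ} (h : E.IsRun master Ξ Q g n)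
    (h' : E.IsRun master Ξ Q' g' n') : ¬ (Q s).rel (g' s) (g s) := by
  have heq : ∀ k, k ≤ n s → k ≤ n' s →
      E.stateAfter master Ξ Q k = E.stateAfter master Ξ Q' k := by
    intro k
    induction k with
    | zero => intro _ _; rfl
    | succ k ih =>
      intro hk hk'
      have ih := ih (by omega) (by omega)
      have hc := h'.not_inCycle (s := s) (k := k) hk'
      rw [stateAfter_succ, stateAfter_succ, ← ih]
      rw [← ih] at hc
      exact step_congr (fun u hu => (hQQ u hu).symm) (h.not_inCycle hk) hc
  -- it suffices that the pair obtained by deviating is on the market when `s` leaves under `Q`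
  suffices hmem : g' s ∈ E.remainingPairs Ξ (E.stateAfter master Ξ Q (n s)) by
    intro hrel
    refine (Q s).asymm hrel ((h.studentPoints s).2.2 _ hmem ?_)
    intro e
    rw [e] at hrel
    exact (Q s).irrefl _ hrel
  have hpt := h'.studentPoints s
  rcases le_or_gt (n s) (n' s) with hle | hlt
  · rw [heq _ le_rfl hle]
    have hrem : g' s ∈ (E.stateAfter master Ξ Q' (n' s + 1)).remaining := by
      rw [stateAfter_succ]; exact hpt.2.1
    have := stateAfter_remaining_anti (Nat.succ_le_succ hle) hrem
    rwa [Nat.succ_eq_add_one, stateAfter_succ] at this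
  · have hcyc := h'.inCycle s
    rw [← heq _ hlt.le le_rfl] at hpt hcyc
    have hoff : ∀ k, n' s ≤ k → k ≤ n s →
        E.Offered master Ξ Q (E.stateAfter master Ξ Q k) s (g' s) := by
      intro k hk
      induction k, hk using Nat.le_induction with
      | base => intro _; exact hcyc.offered_congr hQQ hpt
      | succ k _ ih =>
        intro hk
        rw [stateAfter_succ]
        exact (ih (by omega)).step hB hQ (valid_stateAfter hB hQ h0 k) (h.not_inCycle hk)
    obtain ⟨u, hu, -⟩ := hoff (n s) hlt.le le_rfl
    exact hu.1

end Deviation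

/-! ### From school-type pairs back to schools -/

lemma ownTypeFirst_of_hypothetical {hyp : S → SchoolPref C → StrictPref (C × T)}
    (hhyp : ∀ s P, E.IsHypotheticalPref s P (hyp s P)) (P : S → SchoolPref C) :
    E.OwnTypeFirst fun s => hyp s (P s) :=
  fun s p hp => (hhyp s (P s)).2 p.1 p.2 hp

lemma IsHypotheticalPref.weak_iff {s : S} {P : SchoolPref C} {Q : StrictPref (C × T)}
    (h : E.IsHypotheticalPref s P Q) (c c' : C) :
    P.weak (some c) (some c') ↔ Q.weak (c, E.studentType s) (c', E.studentType s) := by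
  simp only [StrictPref.weak, h.1, Option.some.injEq, Prod.mk.injEq, and_true]

end Problem

end SchoolChoice

theorem theorem6 {S D C T : Type*} [Fintype S] [Fintype D] [Fintype C] [Fintype T]
    (E : Problem S D C T) (f : (C × T → ℕ) → ℝ) (l : ℝ)
    (hf : E.PseudoMConcave f) (hl : l ≤ f (E.dist E.initial))
    (master : StrictPref S) (hyp : S → SchoolPref C → StrictPref (C × T))
    (hhyp : ∀ s P, E.IsHypotheticalPref s P (hyp s P)) :
    (∀ P, E.Feasible (E.ttc master (funPolicy f l) hyp P)) ∧
    (∀ P, E.dist (E.ttc master (funPolicy f l) hyp P) ∈ funPolicy f l) ∧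
    (∀ P, E.ConstrainedEfficient (funPolicy f l) P (E.ttc master (funPolicy f l) hyp P)) ∧
    (∀ P, E.IndividuallyRational P (E.ttc master (funPolicy f l) hyp P)) ∧
    StrategyProof (E.ttc master (funPolicy f l) hyp) := by
  classical
  have hB := E.weakExchange_goalVec hf l
  have h0 := E.initial_mem_goalVec hl
  have hQ := ownTypeFirst_of_hypothetical hhyp
  have hrun : ∀ P : S → SchoolPref C, ∃ (a : S → C) (n : S → ℕ),
      E.IsRun master (funPolicy f l) (fun s => hyp s (P s)) (fun s => (a s, E.studentType s)) n ∧
      E.ttc master (funPolicy f l) hyp P = graph a := fun P => by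
    obtain ⟨g, n, h⟩ := exists_isRun (master := master) hB (hQ P) h0
    have hg : g = fun s => ((g s).1, E.studentType s) := funext fun s =>
      Prod.ext rfl ((hQ P).snd_eq (h.weak_initialPair hB (hQ P) h0 s))
    exact ⟨fun s => (g s).1, n, hg ▸ h, h.ttcOutcome_eq⟩
  have hdist : ∀ P, E.dist (E.ttc master (funPolicy f l) hyp P) ∈
      funPolicy f l ∩ E.fullPolicy := fun P => by
    obtain ⟨a, n, h, heq⟩ := hrun P
    rw [heq]
    have hd := h.dist_mem hB (hQ P) h0
    exact hd
  have hfeas : ∀ P, E.Feasible (E.ttc master (funPolicy f l) hyp P) := fun P => by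
    have := (hdist P).2
    obtain ⟨a, n, h, heq⟩ := hrun P
    rw [heq] at this ⊢
    exact (E.feasible_graph_iff a).2 this
  refine ⟨hfeas, fun P => (hdist P).1, fun P => ⟨hfeas P, (hdist P).1, ?_⟩,
    fun P => ⟨hfeas P, fun s => ?_⟩, fun s P P' => ?_⟩
  · rintro ⟨Y, hY, hYl, hweak, s, hrel⟩
    obtain ⟨a, n, h, heq⟩ := hrun P
    rw [heq, outcome_graph] at hrel
    simp only [heq, outcome_graph] at hweak
    -- everyone is matched at the outcome, hence also at a matching that dominates it
    have hb : ∀ s, ∃ b, outcome Y s = some b := fun s => by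
      rcases hs : outcome Y s with _ | b
      · exact absurd ((P s).outside_least (a s)) ((P s).not_rel_of_weak (hs ▸ hweak s))
      · exact ⟨b, rfl⟩
    choose b hb using hb
    have hYb := E.eq_graph_of_outcome hY hb
    subst hYb
    have hmem := E.toInt_mem_goalVec.2 ⟨hYl, (E.feasible_graph_iff b).1 hY⟩
    rw [toInt_dist_graph] at hmem
    have hzg := h.eq_of_weak hB (hQ P) h0 (z := fun s => (b s, E.studentType s))
      hmem fun s => by
        rw [← (hhyp s (P s)).weak_iff, ← hb s]; exact hweak s
    have hba : b s = a s := congrArg Prod.fst (congrFun hzg s)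
    rw [hb s, hba] at hrel
    exact (P s).irrefl _ hrel
  · obtain ⟨a, n, h, heq⟩ := hrun P
    rw [heq, initial_eq_graph, outcome_graph, outcome_graph, (hhyp s (P s)).weak_iff]
    exact h.weak_initialPair hB (hQ P) h0 s
  · obtain ⟨a, n, h, heq⟩ := hrun P
    obtain ⟨a', n', h', heq'⟩ := hrun (Function.update P s P')
    rw [heq, heq', outcome_graph, outcome_graph, (hhyp s (P s)).1]
    exact h.not_rel_of_deviation hB (hQ P) h0
      (fun u hu => by simp [Function.update_of_ne hu]) h'
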